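/- For integers $k,n\ge 1$ let $C(k,n)$ be the length of the longest word $w$ over the $k$-letter alphabet $\Sigma_k=\{0,1,\dots,k-1\}$ such that no word of length $n$ has two disjoint occurrences in $w$. (Two distinct occurrences $w[i..i+n-1]$ and $w[j..j+n-1]$, $i<j$, of a word of length $n$ are disjoint if they do not overlap, i.e. if $j-i\ge n$.) Then: (a) $C(1,n)=2n-1$ for all $n\ge 1$; (b) $C(k,1)=k$ for all $k\ge 1$; (c) $C(k,2)=k^2+k+1$ for all $k\ge 1$; (d) $C(k,3)=k^3+k^2+k+2$ for all $k\ge 1$. -/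

import Mathlib

namespace DisjointOccurrences

/-- The word `x` occurs in the word `w` at (0-based) position `i`:
`w = p x q` with `|p| = i`. -/
def OccursAt {α : Type*} (x w : List α) (i : ℕ) : Prop :=
  ∃ p q : List α, w = p ++ x ++ q ∧ p.length = i

/-- Some word of length `n` has two distinct occurrences in `w`, at positions `i < j`,
that do not overlap each other (they overlap exactly when `0 < j - i < n`). -/
def HasDisjointOccurrences {α : Type*} (n : ℕ) (w : List α) : Prop :=
  ∃ x : List α, x.length = n ∧
    ∃ i j : ℕ, i < j ∧ OccursAt x w i ∧ OccursAt x w j ∧ i + n ≤ j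

/-- The lengths of the words over the `k`-letter alphabet `{0, …, k-1}` in which no word of
length `n` has two disjoint occurrences. -/
def avoidingLengths (k n : ℕ) : Set ℕ :=
  {L | ∃ w : List (Fin k), w.length = L ∧ ¬ HasDisjointOccurrences n w}

/-- `C k n` is the length of the longest word over `{0, …, k-1}` in which no word of length `n`
has two disjoint occurrences. For `n ≥ 1` the maximum exists, see `isGreatest_C`. -/
noncomputable def C (k n : ℕ) : ℕ :=
  sSup (avoidingLengths k n)

/-- The maximum in the definition of `C` exists as soon as `n ≥ 1`. -/
theorem isGreatest_C (k n : ℕ) (hn : 1 ≤ n) : IsGreatest (avoidingLengths k n) (C k n) := by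
  have hne : (avoidingLengths k n).Nonempty := by
    refine ⟨0, [], rfl, ?_⟩
    rintro ⟨x, hx, i, j, hij, ⟨p, q, h, -⟩, -⟩
    have h' := congrArg List.length h
    simp only [List.length_nil, List.length_append] at h'
    omega
  have hbdd : BddAbove (avoidingLengths k n) := by
    refine ⟨(k ^ n + 1) * n, ?_⟩
    rintro L ⟨w, rfl, hw⟩
    by_contra! hlt
    apply hw
    have hlen : ∀ b : Fin (k ^ n + 1), ((w.drop (b * n)).take n).length = n := by
      intro b
      have : (b + 1 : ℕ) * n ≤ (k ^ n + 1) * n := Nat.mul_le_mul_right _ b.2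
      rw [add_mul] at this
      simp only [List.length_take, List.length_drop]
      omega
    let f : Fin (k ^ n + 1) → List.Vector (Fin k) n :=
      fun b => ⟨(w.drop (b * n)).take n, hlen b⟩
    obtain ⟨a, b, hab, hf⟩ := Fintype.exists_ne_map_eq_of_card_lt f (by simp)
    have key : ∀ a b : Fin (k ^ n + 1), a < b → f a = f b → HasDisjointOccurrences n w := by
      intro a b hab hf
      have hf' : (w.drop (a * n)).take n = (w.drop (b * n)).take n := congrArg Subtype.val hf
      have hle : (a + 1 : ℕ) * n ≤ b * n := Nat.mul_le_mul_right _ hab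
      rw [add_mul] at hle
      have occ : ∀ c : Fin (k ^ n + 1), OccursAt ((w.drop (c * n)).take n) w (c * n) := by
        intro c
        refine ⟨w.take (c * n), (w.drop (c * n)).drop n, ?_, ?_⟩
        · rw [List.append_assoc, List.take_append_drop, List.take_append_drop]
        · have : (c : ℕ) * n ≤ (k ^ n + 1) * n := Nat.mul_le_mul_right _ c.2.le
          simp only [List.length_take]
          omega
      refine ⟨(w.drop (a * n)).take n, hlen a, a * n, b * n, by omega, occ a, ?_, by omega⟩
      rw [hf']
      exact occ b
    rcases lt_or_gt_of_ne hab with h | h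
    · exact key a b h hf
    · exact key b a h hf.symm
  exact ⟨Nat.sSup_mem hne hbdd, fun _ h => le_csSup hbdd h⟩

end DisjointOccurrences

/-!
Call a length-`n` factor of `w` at a given position a window, so that `w` has `|w| - n + 1` windows.
If no word of length `n` has two disjoint occurrences, then any two windows with the same content
start fewer than `n` positions apart. Two equal windows at distance `d` make the word `d`-periodic
there. For `n = 2` a word `aa` thus occurs at most twice and any other pair at most once. For
`n = 3` a word `aaa` occurs at most three times, a word `aba` at most twice, any other triple at
most once. Summing over all words of length `n` gives the upper bounds
(`length_le_of_avoids_two`, `length_le_of_avoids_three`). The cases `k = 1` and `n = 1` are direct.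

For the lower bounds every such overlap has to be realised at once. The words are
read off an Eulerian trail of a multigraph whose vertices are words of length `n - 1`, but whose
edges may spell several letters. For `n = 2` the loop at `a` spells `aaa`. For `n = 3` the edges are
`ab → bc` for `a ≠ c`, a loop at `aa` spelling `aaaaa`, and a loop at `ab` with `a < b` spelling
`ababab`, which uses up both occurrences of `aba` and of `bab`. No edge spells a word with disjoint
occurrences, and distinct edges share no window. Hence a trail without repeated edges spells a word
without disjoint occurrences (`not_hasDisjointOccurrences_trail`), and the Eulerian trail given by
`exists_eulerian_trail` has the required length (`exists_word_of_balanced`).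
-/

namespace DisjointOccurrences

open Finset

/-! ### Eulerian trails in directed multigraphs -/

section Trails

variable {V E : Type*} {s t : E → V}

/-- Along a trail starting at `u`, the edges leaving `x` and the edges entering `x` balance, up to
the two ends of the trail. The empty trail is taken to end where it starts. -/
theorem trail_count [DecidableEq V] (x u : V) (l : List E)
    (hl : l.IsChain fun e f => t e = s f) (hu : ∀ e ∈ l.head?, s e = u) :
    l.countP (s · = x) + (if (l.getLast?.map t).getD u = x then 1 else 0) =
      l.countP (t · = x) + (if u = x then 1 else 0) := by
  induction l generalizing u with
  | nil => simp; rfl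
  | cons e l ih =>
    have hs : s e = u := hu e (by simp)
    have h := ih (t e) hl.tail (by
      cases l with
      | nil => simp
      | cons f l => simpa [eq_comm] using hl.rel)
    have hlast : ((e :: l).getLast?.map t).getD u = (l.getLast?.map t).getD (t e) := by
      cases l with
      | nil => simp
      | cons f l => simp [List.getLast?_cons]
    rw [hlast, List.countP_cons, List.countP_cons]
    simp only [decide_eq_true_eq, hs]
    omega

/-- Euler's theorem for a finite directed multigraph with edge set `E`, where `e` runs from `s e` to
`t e`: if every vertex has equal in- and outdegree and each edge can be reached from each other one,
then some trail runs through every edge exactly once. A longest trail does. -/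
theorem exists_eulerian_trail [Finite E] [DecidableEq V]
    (hbal : ∀ v, Nat.card {e // s e = v} = Nat.card {e // t e = v})
    (hconn : ∀ e f, Relation.ReflTransGen (fun u v => ∃ g, s g = u ∧ t g = v) (s e) (s f)) :
    ∃ l : List E, (l.IsChain fun e f => t e = s f) ∧ l.Nodup ∧ ∀ e, e ∈ l := by
  classical
  have := Fintype.ofFinite E
  let P : ℕ → Prop := fun m => ∃ l : List E,
    (l.IsChain fun e f => t e = s f) ∧ l.Nodup ∧ l.length = m
  have hP0 : P 0 := ⟨[], by simp, by simp, rfl⟩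
  have hPle : ∀ m, P m → m ≤ Fintype.card E := by
    rintro m ⟨l, -, hnd, rfl⟩
    exact hnd.length_le_card
  obtain ⟨l, hl, hnd, hlen⟩ := Nat.findGreatest_spec (P := P) (Nat.zero_le (Fintype.card E)) hP0
  have hmax : ∀ l' : List E, (l'.IsChain fun e f => t e = s f) → l'.Nodup →
      l'.length ≤ l.length := fun l' h1 h2 => by
    rw [hlen]
    exact Nat.le_findGreatest (hPle _ ⟨l', h1, h2, rfl⟩) ⟨l', h1, h2, rfl⟩
  refine ⟨l, hl, hnd, ?_⟩
  have hcount : ∀ (g : E → V) (v : V), l.countP (g · = v) ≤ Nat.card {e // g e = v} ∧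
      ((∀ e, g e = v → e ∈ l) → l.countP (g · = v) = Nat.card {e // g e = v}) := by
    intro g v
    have h1 : l.countP (g · = v) = #((l.filter (g · = v)).toFinset) := by
      rw [List.toFinset_card_of_nodup (hnd.filter _), List.countP_eq_length_filter]
    have h2 : Nat.card {e // g e = v} = #{e | g e = v} := by
      rw [Nat.card_eq_fintype_card, Fintype.card_subtype]
    rw [h1, h2]
    constructor
    · exact card_le_card fun e he => by simp at he ⊢; exact he.2
    · intro h
      congr 1
      ext e
      simpa using h e
  intro e
  rcases List.eq_nil_or_concat l with rfl | ⟨l₀, z, rfl⟩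
  · have := hmax [e] (by simp) (by simp)
    simp at this
  rw [List.concat_eq_append] at *
  set l := l₀ ++ [z] with hldef
  -- Every edge leaving the last vertex of a longest trail lies on the trail.
  have hout : ∀ f, s f = t z → f ∈ l := by
    intro f hf
    by_contra hfl
    have := hmax (l ++ [f])
      (List.isChain_append.2 ⟨hl, by simp, by simp [hldef, hf]⟩)
      (by rw [List.nodup_append]; exact ⟨hnd, by simp, by simp; rintro a ha rfl; exact hfl ha⟩)
    simp at this
  obtain ⟨y, l₁, hy⟩ : ∃ y l₁, l = y :: l₁ := by
    rcases hc : l with _ | ⟨y, l₁⟩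
    · simp [hldef] at hc
    · exact ⟨y, l₁, rfl⟩
  have hclosed : t z = s y := by
    by_contra hne
    have h := trail_count (t z) (s y) l hl (by simp [hy])
    have hlast : l.getLast? = some z := by simp [hldef]
    have h1 := (hcount s (t z)).2 hout
    have h2 := (hcount t (t z)).1
    have h3 := hbal (t z)
    simp [hlast, Ne.symm hne] at h
    omega
  -- Rotating a closed longest trail lets it end at any of its edges.
  have hstep : ∀ g ∈ l, ∀ f, s f = t g → f ∈ l := by
    intro g hg f hf
    by_contra hfl
    obtain ⟨p, q, hpq⟩ := List.append_of_mem hg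
    rw [List.append_cons] at hpq
    have hrot : (q ++ (p ++ [g])).IsChain fun e f => t e = s f := by
      rw [hpq, List.isChain_append] at hl
      refine List.isChain_append.2 ⟨hl.2.1, hl.1, ?_⟩
      intro a ha b hb
      have haz : a = z := by
        have : l.getLast? = some a := by
          rw [hpq, List.getLast?_append, Option.mem_def.1 ha]; rfl
        simpa [hldef] using this.symm
      have hby : b = y := by
        have : l.head? = some b := by
          rw [hpq, List.head?_append, Option.mem_def.1 hb]; rfl
        simpa [hy] using this.symm
      rw [haz, hby, hclosed]
    have hperm : (q ++ (p ++ [g])).Perm l := by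
      rw [hpq]; exact List.perm_append_comm
    have hchain : ((q ++ (p ++ [g])) ++ [f]).IsChain fun e f => t e = s f := by
      refine List.isChain_append.2 ⟨hrot, by simp, ?_⟩
      rw [← List.append_assoc]
      simp [hf]
    have hnd' : ((q ++ (p ++ [g])) ++ [f]).Nodup := by
      rw [List.nodup_append]
      refine ⟨hperm.nodup_iff.2 hnd, by simp, ?_⟩
      rintro a ha b hb rfl
      rw [List.mem_singleton.1 hb] at ha
      exact hfl (hperm.subset ha)
    have h := hmax _ hchain hnd'
    rw [List.length_append, hperm.length_eq] at h
    simp at h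
  have hreach : ∀ v, Relation.ReflTransGen (fun u v => ∃ g, s g = u ∧ t g = v) (s y) v →
      ∃ g ∈ l, t g = v := by
    intro v hv
    induction hv with
    | refl => exact ⟨z, by simp [hldef], hclosed⟩
    | tail _ h ih =>
      obtain ⟨g, hg, rfl⟩ := ih
      obtain ⟨f, hf, rfl⟩ := h
      exact ⟨f, hstep g hg f hf, rfl⟩
  obtain ⟨g, hg, hge⟩ := hreach _ (hconn y e)
  exact hstep g hg e hge.symm

end Trails

/-! ### Occurrences and gluing -/

section Words

variable {α : Type*}

theorem OccursAt.add_length_le {x w : List α} {i : ℕ} (h : OccursAt x w i) :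
    i + x.length ≤ w.length := by
  obtain ⟨p, q, rfl, rfl⟩ := h
  simp only [List.length_append]
  omega

theorem occursAt_iff {x w : List α} {i : ℕ} :
    OccursAt x w i ↔ i ≤ w.length ∧ x <+: w.drop i := by
  constructor
  · rintro ⟨p, q, rfl, rfl⟩
    simp
  · rintro ⟨hi, q, hq⟩
    exact ⟨w.take i, q, by rw [List.append_assoc, hq, List.take_append_drop], by simpa using hi⟩

theorem OccursAt.eq_take_drop {x w : List α} {i : ℕ} (h : OccursAt x w i) :
    x = (w.drop i).take x.length :=
  List.prefix_iff_eq_take.1 (occursAt_iff.1 h).2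

theorem occursAt_take_drop {w : List α} {n i : ℕ} (h : i + n ≤ w.length) :
    OccursAt ((w.drop i).take n) w i :=
  occursAt_iff.2 ⟨by omega, List.take_prefix _ _⟩

theorem OccursAt.of_append_left {x p w : List α} {i : ℕ} (h : OccursAt x (p ++ w) i)
    (hi : p.length ≤ i) : OccursAt x w (i - p.length) := by
  rw [occursAt_iff] at h ⊢
  rw [List.length_append, List.drop_append, List.drop_eq_nil_of_le hi, List.nil_append] at h
  exact ⟨by omega, h.2⟩

theorem OccursAt.of_append_right {x w q : List α} {i : ℕ} (h : OccursAt x (w ++ q) i)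
    (hi : i + x.length ≤ w.length) : OccursAt x w i := by
  rw [h.eq_take_drop, List.drop_append_of_le_length (by omega),
    List.take_append_of_le_length (by simp; omega)]
  exact occursAt_take_drop hi

theorem not_hasDisjointOccurrences_of_length_lt {w : List α} {n : ℕ} (h : w.length < 2 * n) :
    ¬ HasDisjointOccurrences n w := by
  rintro ⟨x, hx, i, j, -, -, hj, hij⟩
  have := hj.add_length_le
  omega

theorem hasDisjointOccurrences_of_take_drop_eq {w : List α} {n i j : ℕ} (hn : 1 ≤ n)
    (hij : i + n ≤ j) (hj : j + n ≤ w.length)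
    (h : (w.drop i).take n = (w.drop j).take n) : HasDisjointOccurrences n w :=
  ⟨(w.drop i).take n, by simp; omega, i, j, by omega, occursAt_take_drop (by omega),
    h ▸ occursAt_take_drop hj, hij⟩

/-- A window one letter longer than the overlap `v` lies in one of the two overlapping parts. -/
theorem OccursAt.split {x p v q : List α} {i : ℕ} (h : OccursAt x (p ++ v ++ q) i)
    (hx : x.length = v.length + 1) :
    OccursAt x (p ++ v) i ∨ p.length ≤ i ∧ OccursAt x (v ++ q) (i - p.length) := by
  rcases lt_or_ge i p.length with hi | hi
  · exact .inl (h.of_append_right (by simp; omega))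
  · rw [List.append_assoc] at h
    exact .inr ⟨hi, h.of_append_left hi⟩

/-- Two words overlapping in `v` and sharing no window of length `|v| + 1` may be glued along `v`:
the windows of the result are those of the two parts, and positions within a part are only
translated, so that overlaps are kept. -/
theorem not_hasDisjointOccurrences_glue {p v q : List α}
    (h₁ : ¬ HasDisjointOccurrences (v.length + 1) (p ++ v))
    (h₂ : ¬ HasDisjointOccurrences (v.length + 1) (v ++ q))
    (h : ∀ x i j, x.length = v.length + 1 → OccursAt x (p ++ v) i → ¬ OccursAt x (v ++ q) j) :
    ¬ HasDisjointOccurrences (v.length + 1) (p ++ v ++ q) := by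
  rintro ⟨x, hx, i, j, hij, hi, hj, hd⟩
  rcases hi.split hx with hi | ⟨hi', hi⟩ <;> rcases hj.split hx with hj | ⟨hj', hj⟩
  · exact h₁ ⟨x, hx, i, j, hij, hi, hj, hd⟩
  · exact h x _ _ hx hi hj
  · exact h x _ _ hx hj hi
  · exact h₂ ⟨x, hx, _, _, by omega, hi, hj, by omega⟩

variable {V E : Type*} {s t : E → V} {vert : V → List α} {ext : E → List α} {m : ℕ}

/-- Vertices are labelled by words `vert v` of length `m`, and traversing the edge `e` appends the
letters `ext e`, after which the last `m` letters read `vert (t e)`. If the words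
`vert (s e) ++ ext e` spelled by single edges have no disjoint occurrences and share no window of
length `m + 1`, then a trail spells a word without disjoint occurrences. The second conclusion, that
every window comes from an edge of the trail, is what carries the induction. -/
theorem not_hasDisjointOccurrences_trail (hvert : ∀ v, (vert v).length = m)
    (hext : ∀ e, vert (t e) <:+ vert (s e) ++ ext e)
    (hgood : ∀ e, ¬ HasDisjointOccurrences (m + 1) (vert (s e) ++ ext e))
    (hdisj : ∀ x e f i j, x.length = m + 1 → OccursAt x (vert (s e) ++ ext e) i →
      OccursAt x (vert (s f) ++ ext f) j → e = f)
    (u : V) (l : List E) (hl : l.IsChain fun e f => t e = s f) (hnd : l.Nodup)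
    (hu : ∀ e ∈ l.head?, s e = u) :
    ¬ HasDisjointOccurrences (m + 1) (vert u ++ l.flatMap ext) ∧
      ∀ x i, x.length = m + 1 → OccursAt x (vert u ++ l.flatMap ext) i →
        ∃ e ∈ l, ∃ j, OccursAt x (vert (s e) ++ ext e) j := by
  induction l generalizing u with
  | nil =>
    simp only [List.flatMap_nil, List.append_nil]
    refine ⟨not_hasDisjointOccurrences_of_length_lt (by rw [hvert]; omega), fun x i hx h => ?_⟩
    have := h.add_length_le
    rw [hvert] at this
    omega
  | cons e l ih =>
    obtain rfl : s e = u := hu e (by simp)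
    obtain ⟨ih₁, ih₂⟩ := ih (t e) hl.tail hnd.of_cons (by
      cases l with
      | nil => simp
      | cons f l => simpa [eq_comm] using hl.rel)
    obtain ⟨p, hp⟩ := hext e
    have hm := hvert (t e)
    have hw : vert (s e) ++ (e :: l).flatMap ext = p ++ vert (t e) ++ l.flatMap ext := by
      rw [List.flatMap_cons, ← List.append_assoc, hp]
    rw [hw]
    constructor
    · rw [← hm] at ih₁ ⊢
      refine not_hasDisjointOccurrences_glue (by rw [hp, hm]; exact hgood e) ih₁ ?_
      intro x i j hx hi hj
      rw [hm] at hx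
      obtain ⟨f, hf, k, hk⟩ := ih₂ x j hx hj
      rw [hp] at hi
      exact (List.nodup_cons.1 hnd).1 (hdisj x e f i k hx hi hk ▸ hf)
    · intro x i hx hi
      rcases hi.split (by omega) with h | ⟨-, h⟩
      · exact ⟨e, by simp, i, hp ▸ h⟩
      · obtain ⟨f, hf, hj⟩ := ih₂ x _ hx h
        exact ⟨f, by simp [hf], hj⟩

/-- The word spelled by an Eulerian trail, for edges labelled as in
`not_hasDisjointOccurrences_trail`. -/
theorem exists_word_of_balanced [Fintype E] [Nonempty E] (hvert : ∀ v, (vert v).length = m)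
    (hext : ∀ e, vert (t e) <:+ vert (s e) ++ ext e)
    (hgood : ∀ e, ¬ HasDisjointOccurrences (m + 1) (vert (s e) ++ ext e))
    (hdisj : ∀ x e f i j, x.length = m + 1 → OccursAt x (vert (s e) ++ ext e) i →
      OccursAt x (vert (s f) ++ ext f) j → e = f)
    (hbal : ∀ v, Nat.card {e // s e = v} = Nat.card {e // t e = v})
    (hconn : ∀ e f, Relation.ReflTransGen (fun u v => ∃ g, s g = u ∧ t g = v) (s e) (s f)) :
    ∃ w : List α, w.length = m + ∑ e, (ext e).length ∧ ¬ HasDisjointOccurrences (m + 1) w := by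
  classical
  obtain ⟨l, hl, hnd, hall⟩ := exists_eulerian_trail hbal hconn
  obtain ⟨e, l', rfl⟩ : ∃ e l', l = e :: l' :=
    List.exists_cons_of_ne_nil (List.ne_nil_of_mem (hall (Classical.arbitrary E)))
  refine ⟨_, ?_, (not_hasDisjointOccurrences_trail hvert hext hgood hdisj (s e) _ hl hnd (by simp)).1⟩
  rw [List.length_append, hvert, List.length_flatMap, ← List.sum_toFinset _ hnd,
    Finset.eq_univ_of_forall fun e => List.mem_toFinset.2 (hall e)]

/-! ### Upper bounds -/

theorem C_eq {k n L : ℕ} (hn : 1 ≤ n)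
    (hlow : ∃ w : List (Fin k), w.length = L ∧ ¬ HasDisjointOccurrences n w)
    (hup : ∀ w : List (Fin k), ¬ HasDisjointOccurrences n w → w.length ≤ L) : C k n = L :=
  (isGreatest_C k n hn).unique ⟨hlow, by rintro _ ⟨w, rfl, hw⟩; exact hup w hw⟩

theorem C_one_left {n : ℕ} (hn : 1 ≤ n) : C 1 n = 2 * n - 1 := by
  refine C_eq hn ⟨List.replicate (2 * n - 1) 0, by simp,
    not_hasDisjointOccurrences_of_length_lt (by simp; omega)⟩ fun w hw => ?_
  by_contra! hlt
  refine hw (hasDisjointOccurrences_of_take_drop_eq (i := 0) (j := n) hn (by omega) (by omega) ?_)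
  refine List.ext_getElem (by simp; omega) fun _ _ _ => Subsingleton.elim _ _

/-- If each value `b` is the content of at most `c b` of the `N` windows, then `N` is at most the sum
of the bounds. -/
theorem card_windows_le {β : Type*} [Fintype β] [DecidableEq β] (f : ℕ → β) (c : β → ℕ) (N : ℕ)
    (h : ∀ b, #{i ∈ range N | f i = b} ≤ c b) : N ≤ ∑ b, c b := by
  calc N = #(range N) := (card_range N).symm
    _ = ∑ b, #{i ∈ range N | f i = b} :=
      card_eq_sum_card_fiberwise fun _ _ => Finset.mem_coe.2 (mem_univ _)
    _ ≤ _ := sum_le_sum fun b _ => h b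

theorem exists_getD_ne {w : List α} {n i j : ℕ} (hw : ¬ HasDisjointOccurrences n w) (d : α)
    (hn : 1 ≤ n) (hij : i + n ≤ j) (hj : j + n ≤ w.length) :
    ∃ r < n, w.getD (i + r) d ≠ w.getD (j + r) d := by
  by_contra! h
  refine hw (hasDisjointOccurrences_of_take_drop_eq hn hij hj ?_)
  refine List.ext_getElem (by simp; omega) fun r h₁ h₂ => ?_
  simp only [List.length_take, List.length_drop] at h₁ h₂
  have := h r (by omega)
  rw [List.getD_eq_getElem _ _ (by omega), List.getD_eq_getElem _ _ (by omega)] at this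
  simpa using this

theorem card_le_of_forall_lt_add {F : Finset ℕ} {r : ℕ}
    (h : ∀ i ∈ F, ∀ j ∈ F, i < j → j < i + r) (hr : 1 ≤ r) : #F ≤ r := by
  rcases F.eq_empty_or_nonempty with rfl | hF
  · simp
  have hsub : F ⊆ Ico (F.min' hF) (F.min' hF + r) := by
    intro j hj
    have hle := F.min'_le j hj
    rcases hle.eq_or_lt with heq | hlt
    · rw [mem_Ico]; omega
    · exact mem_Ico.2 ⟨hle, h _ (F.min'_mem hF) _ hj hlt⟩
  simpa using card_le_card hsub

theorem card_le_two_of_forall_eq_add_two {F : Finset ℕ}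
    (h : ∀ i ∈ F, ∀ j ∈ F, i < j → j = i + 2) : #F ≤ 2 := by
  rcases F.eq_empty_or_nonempty with rfl | hF
  · simp
  have hsub : F ⊆ {F.min' hF, F.min' hF + 2} := by
    intro j hj
    rw [mem_insert, mem_singleton]
    rcases (F.min'_le j hj).eq_or_lt with heq | hlt
    · exact .inl heq.symm
    · exact .inr (h _ (F.min'_mem hF) _ hj hlt)
  exact (card_le_card hsub).trans card_le_two

theorem length_le_of_avoids_one {k : ℕ} {w : List (Fin k)} (hw : ¬ HasDisjointOccurrences 1 w) :
    w.length ≤ k := by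
  have hnd : w.Nodup := by
    rw [List.nodup_iff_pairwise_ne, List.pairwise_iff_getElem]
    intro i j hi hj hij heq
    obtain ⟨r, hr, hne⟩ := exists_getD_ne hw w[i] le_rfl hij hj
    obtain rfl : r = 0 := by omega
    simp [hi, hj, heq] at hne
  simpa using hnd.length_le_card

theorem length_le_of_avoids_two {k : ℕ} [NeZero k] {w : List (Fin k)}
    (hw : ¬ HasDisjointOccurrences 2 w) : w.length ≤ k ^ 2 + k + 1 := by
  have key := card_windows_le (fun i => (w.getD i 0, w.getD (i + 1) 0))
    (fun b : Fin k × Fin k => 1 + if b.1 = b.2 then 1 else 0) (w.length - 1) ?_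
  · simp only [sum_add_distrib, Fintype.sum_prod_type, sum_ite_eq, mem_univ, if_true] at key
    simp at key
    have : k ^ 2 = k * k := sq k
    omega
  rintro ⟨a, b⟩
  dsimp only
  have hclose : ∀ i ∈ {i ∈ range (w.length - 1) | (w.getD i 0, w.getD (i + 1) 0) = (a, b)},
      ∀ j ∈ {i ∈ range (w.length - 1) | (w.getD i 0, w.getD (i + 1) 0) = (a, b)}, i < j →
        j = i + 1 ∧ a = b := by
    intro i hi j hj hij
    simp only [mem_filter, mem_range, Prod.mk.injEq] at hi hj
    have hlt : j < i + 2 := by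
      by_contra! hge
      obtain ⟨r, hr, hne⟩ := exists_getD_ne hw 0 (by omega) hge (by omega)
      interval_cases r <;> simp_all
    obtain rfl : j = i + 1 := by omega
    exact ⟨rfl, hj.2.1.symm.trans hi.2.2⟩
  split_ifs with hab
  · exact card_le_of_forall_lt_add (fun i hi j hj hij => by
      have := (hclose i hi j hj hij).1; omega) (by omega)
  · exact card_le_of_forall_lt_add (fun i hi j hj hij =>
      absurd (hclose i hi j hj hij).2 hab) le_rfl

theorem length_le_of_avoids_three {k : ℕ} [NeZero k] {w : List (Fin k)}
    (hw : ¬ HasDisjointOccurrences 3 w) : w.length ≤ k ^ 3 + k ^ 2 + k + 2 := by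
  have key := card_windows_le (fun i => (w.getD i 0, w.getD (i + 1) 0, w.getD (i + 2) 0))
    (fun b : Fin k × Fin k × Fin k =>
      1 + if b.1 = b.2.2 then 1 + if b.1 = b.2.1 then 1 else 0 else 0) (w.length - 2) ?_
  · simp only [sum_add_distrib, Fintype.sum_prod_type, sum_ite_eq, mem_univ, if_true] at key
    simp at key
    have : k ^ 3 + k ^ 2 + k = k * (k * k) + (k * k + k) := by ring
    omega
  rintro ⟨a, b, c⟩
  dsimp only
  set F := {i ∈ range (w.length - 2) |
    (w.getD i 0, w.getD (i + 1) 0, w.getD (i + 2) 0) = (a, b, c)} with hF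
  have hclose : ∀ i ∈ F, ∀ j ∈ F, i < j →
      (j = i + 1 ∧ a = b ∧ a = c) ∨ (j = i + 2 ∧ a = c) := by
    intro i hi j hj hij
    simp only [hF, mem_filter, mem_range, Prod.mk.injEq] at hi hj
    have hlt : j < i + 3 := by
      by_contra! hge
      obtain ⟨r, hr, hne⟩ := exists_getD_ne hw 0 (by omega) hge (by omega)
      interval_cases r <;> simp_all
    obtain rfl | rfl : j = i + 1 ∨ j = i + 2 := by omega
    · have hab : a = b := hj.2.1.symm.trans hi.2.2.1
      exact .inl ⟨rfl, hab, hab.trans (hj.2.2.1.symm.trans hi.2.2.2)⟩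
    · exact .inr ⟨rfl, hj.2.1.symm.trans hi.2.2.2⟩
  split_ifs with hac hab
  · exact card_le_of_forall_lt_add (fun i hi j hj hij => by
      have := hclose i hi j hj hij; omega) (by omega)
  · refine card_le_two_of_forall_eq_add_two fun i hi j hj hij => ?_
    rcases hclose i hi j hj hij with h | h
    · exact absurd h.2.1 hab
    · exact h.1
  · refine card_le_of_forall_lt_add (fun i hi j hj hij => absurd ?_ hac) le_rfl
    rcases hclose i hi j hj hij with h | h
    exacts [h.2.2, h.2]

/-! ### Extremal words -/

theorem C_one_right (k : ℕ) : C k 1 = k := by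
  refine C_eq le_rfl ⟨List.finRange k, by simp, ?_⟩ fun w => length_le_of_avoids_one
  rintro ⟨x, hx, i, j, hij, hi, hj, -⟩
  have hil := hi.add_length_le
  have hjl := hj.add_length_le
  have h := hi.eq_take_drop.symm.trans hj.eq_take_drop
  rw [hx, List.take_one_drop_eq_of_lt_length (by omega),
    List.take_one_drop_eq_of_lt_length (by omega)] at h
  simp at h
  omega

theorem C_two_right {k : ℕ} (hk : 1 ≤ k) : C k 2 = k ^ 2 + k + 1 := by
  have : NeZero k := ⟨by omega⟩
  refine C_eq (by omega) ?_ fun w => length_le_of_avoids_two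
  let ext : Fin k × Fin k → List (Fin k) := fun e => if e.1 = e.2 then [e.1, e.1] else [e.2]
  suffices h : ∃ w : List (Fin k), w.length = 1 + ∑ e, (ext e).length ∧
      ¬ HasDisjointOccurrences 2 w by
    obtain ⟨w, hlen, hw⟩ := h
    refine ⟨w, ?_, hw⟩
    have : ∀ e : Fin k × Fin k, (ext e).length = 1 + if e.1 = e.2 then 1 else 0 := by
      intro e; dsimp only [ext]; split_ifs <;> rfl
    simp only [hlen, this, sum_add_distrib, Fintype.sum_prod_type, sum_ite_eq, mem_univ, if_true]
    simp
    ring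
  refine exists_word_of_balanced (s := Prod.fst) (t := Prod.snd)
    (vert := fun v : Fin k => [v]) (ext := ext) (m := 1) (fun _ => rfl) ?_ ?_ ?_ ?_ ?_
  · rintro ⟨a, b⟩
    by_cases hab : a = b
    · exact ⟨[a, a], by simp [ext, hab]⟩
    · exact ⟨[a], by simp [ext, hab]⟩
  · rintro ⟨a, b⟩
    refine not_hasDisjointOccurrences_of_length_lt ?_
    dsimp only [ext]
    split_ifs <;> simp
  · have hocc : ∀ (x : List (Fin k)) (e : Fin k × Fin k) (i : ℕ), x.length = 1 + 1 →
        OccursAt x ([e.1] ++ ext e) i → x = [e.1, e.2] := by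
      rintro x ⟨a, b⟩ i hx h
      have hl := h.add_length_le
      rw [h.eq_take_drop, hx]
      rw [hx] at hl
      by_cases hab : a = b
      · simp [ext, hab] at hl ⊢
        interval_cases i <;> simp
      · simp [ext, hab] at hl ⊢
        simp [hl]
    intro x e f i j hx he hf
    have h := (hocc x e i hx he).symm.trans (hocc x f j hx hf)
    simp only [List.cons.injEq, and_true] at h
    exact Prod.ext h.1 h.2
  · intro v
    exact Nat.card_congr ((Equiv.prodComm _ _).subtypeEquiv fun _ => Iff.rfl)
  · intro e f
    exact .single ⟨(e.1, f.1), rfl, rfl⟩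

theorem C_three_right {k : ℕ} (hk : 1 ≤ k) : C k 3 = k ^ 3 + k ^ 2 + k + 2 := by
  have : NeZero k := ⟨by omega⟩
  refine C_eq (by omega) ?_ fun w => length_le_of_avoids_three
  -- Edges are indexed by all triples `(a, b, c)`. Those with `a = c` are loops at `ab`. For `b < a`
  -- this loop spells nothing, since the loop at `ba` already spells `bab` and `aba` twice each.
  let loop : Fin k → Fin k → List (Fin k) := fun a b =>
    if a = b then [a, a, a] else if a < b then [a, b, a, b] else []
  let s : Fin k × Fin k × Fin k → Fin k × Fin k := fun e => (e.1, e.2.1)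
  let t : Fin k × Fin k × Fin k → Fin k × Fin k :=
    fun e => if e.1 = e.2.2 then (e.1, e.2.1) else (e.2.1, e.2.2)
  let ext : Fin k × Fin k × Fin k → List (Fin k) :=
    fun e => if e.1 = e.2.2 then loop e.1 e.2.1 else [e.2.2]
  suffices h : ∃ w : List (Fin k), w.length = 2 + ∑ e, (ext e).length ∧
      ¬ HasDisjointOccurrences 3 w by
    obtain ⟨w, hlen, hw⟩ := h
    refine ⟨w, ?_, hw⟩
    have h₁ : ∀ a b c : Fin k, ((ext (a, b, c)).length : ℤ) =
        1 + if a = c then ((loop a b).length : ℤ) - 1 else 0 := by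
      intro a b c; dsimp only [ext]; split_ifs <;> simp
    have h₂ : ∀ a b : Fin k, ((loop a b).length : ℤ) + (loop b a).length =
        4 + if a = b then 2 else 0 := by
      intro a b
      dsimp only [loop]
      rcases lt_trichotomy a b with h | rfl | h
      · simp [h, h.ne, h.ne', h.not_gt]
      · simp
      · simp [h, h.ne, h.ne', h.not_gt]
    -- Adding the sum to its transpose removes the dependence on the order of `a` and `b`.
    have h₃ : (∑ a, ∑ b, ((loop a b).length : ℤ)) + ∑ a, ∑ b, ((loop a b).length : ℤ) =
        4 * k ^ 2 + 2 * k := by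
      nth_rewrite 2 [sum_comm]
      simp only [← sum_add_distrib, h₂]
      simp [sum_add_distrib]
      ring
    zify [hlen]
    simp only [Fintype.sum_prod_type, h₁, sum_add_distrib, sum_ite_eq, mem_univ, if_true,
      sum_sub_distrib]
    simp
    linarith
  refine exists_word_of_balanced (s := s) (t := t)
    (vert := fun v : Fin k × Fin k => [v.1, v.2]) (ext := ext) (m := 2) (fun _ => rfl)
    ?_ ?_ ?_ ?_ ?_
  · rintro ⟨a, b, c⟩
    dsimp only [ext, s, t, loop]
    split_ifs with hac hab hlt
    · exact ⟨[a, a, a], by simp [hab]⟩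
    · exact ⟨[a, b, a, b], by simp⟩
    · exact ⟨[], by simp⟩
    · exact ⟨[a], by simp⟩
  · rintro ⟨a, b, c⟩
    dsimp only [ext, s, loop]
    split_ifs with hac hab hlt
    · exact not_hasDisjointOccurrences_of_length_lt (by simp)
    · rintro ⟨x, hx, i, j, -, hi, hj, hij⟩
      have hl := hj.add_length_le
      simp [hx] at hl
      obtain ⟨rfl, rfl⟩ : i = 0 ∧ j = 3 := by omega
      have h := hi.eq_take_drop.symm.trans hj.eq_take_drop
      simp [hx] at h
      exact hab h.1
    · exact not_hasDisjointOccurrences_of_length_lt (by simp)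
    · exact not_hasDisjointOccurrences_of_length_lt (by simp)
  -- The only edge that can spell a window is a function of that window.
  · have hocc : ∀ (x : List (Fin k)) (e : Fin k × Fin k × Fin k) (i : ℕ), x.length = 2 + 1 →
        OccursAt x ([(s e).1, (s e).2] ++ ext e) i → ∃ a b c, x = [a, b, c] ∧
          e = if a = c then (min a b, max a b, min a b) else (a, b, c) := by
      rintro x ⟨a, b, c⟩ i hx h
      have hl := h.add_length_le
      rw [h.eq_take_drop, hx]
      rw [hx] at hl
      clear h
      dsimp only [ext, s, loop] at hl ⊢
      split_ifs at hl ⊢ with hac hab hlt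
      · subst hac hab
        simp at hl
        interval_cases i <;> exact ⟨a, a, a, by simp⟩
      · subst hac
        simp at hl
        interval_cases i
        · exact ⟨a, b, a, by simp [hlt.le]⟩
        · exact ⟨b, a, b, by simp [hlt.le]⟩
        · exact ⟨a, b, a, by simp [hlt.le]⟩
        · exact ⟨b, a, b, by simp [hlt.le]⟩
      · simp at hl
      · simp at hl
        exact ⟨a, b, c, by simp [hl, hac]⟩
    intro x e f i j hx he hf
    obtain ⟨a, b, c, rfl, rfl⟩ := hocc x e i hx he
    obtain ⟨a', b', c', hx', rfl⟩ := hocc _ f j hx hf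
    simp only [List.cons.injEq, and_true] at hx'
    obtain ⟨rfl, rfl, rfl⟩ := hx'
    rfl
  · intro v
    -- `g e` is an edge that leaves the end of `e`, and `g` is a bijection: the swap of `b` and `c`
    -- turns the condition `a ≠ c` on the first letter into the condition that the new last letter
    -- differs from `b`.
    let g : Fin k × Fin k × Fin k → Fin k × Fin k × Fin k :=
      fun e => if e.1 = e.2.2 then e else (e.2.1, e.2.2, Equiv.swap e.2.1 e.2.2 e.1)
    have hg : Function.Bijective g := by
      rw [← Finite.injective_iff_bijective]
      rintro ⟨a, b, c⟩ ⟨a', b', c'⟩ h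
      have hswap : ∀ x y z : Fin k, x ≠ z → y ≠ Equiv.swap y z x := by
        intro x y z hxz h
        rw [eq_comm, Equiv.swap_apply_eq_iff, Equiv.swap_apply_left] at h
        exact hxz h
      dsimp only [g] at h
      split_ifs at h with h₁ h₂ h₂
      · exact h
      · simp only [Prod.mk.injEq] at h
        exact absurd (h.1.symm.trans (h₁.trans h.2.2)) (hswap a' b' c' h₂)
      · simp only [Prod.mk.injEq] at h
        exact absurd (h.1.trans (h₂.trans h.2.2.symm)) (hswap a b c h₁)
      · simp only [Prod.mk.injEq] at h
        obtain ⟨rfl, rfl, h⟩ := h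
        rw [(Equiv.swap b c).injective h]
    refine (Nat.card_congr ((Equiv.ofBijective g hg).subtypeEquiv fun e => ?_)).symm
    simp only [Equiv.ofBijective_apply, s, t, g]
    split_ifs <;> rfl
  · have hstep : ∀ a b c : Fin k, a ≠ c →
        Relation.ReflTransGen (fun u v => ∃ g, s g = u ∧ t g = v) (a, b) (b, c) :=
      fun a b c h => .single ⟨(a, b, c), rfl, by simp [t, h]⟩
    have hdiag : ∀ a b : Fin k,
        Relation.ReflTransGen (fun u v => ∃ g, s g = u ∧ t g = v) (a, b) (b, b) := by
      intro a b
      by_cases h : a = b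
      · rw [h]
      · exact hstep a b b h
    have hdiag' : ∀ a b : Fin k,
        Relation.ReflTransGen (fun u v => ∃ g, s g = u ∧ t g = v) (a, a) (a, b) := by
      intro a b
      by_cases h : a = b
      · rw [h]
      · exact hstep a a b h
    rintro ⟨a, b, -⟩ ⟨c, d, -⟩
    exact (hdiag a b).trans ((hdiag' b c).trans ((hdiag b c).trans (hdiag' c d)))

end Words

end DisjointOccurrences

theorem theorem8 :
    (∀ n : ℕ, 1 ≤ n → DisjointOccurrences.C 1 n = 2 * n - 1) ∧
    (∀ k : ℕ, 1 ≤ k → DisjointOccurrences.C k 1 = k) ∧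
    (∀ k : ℕ, 1 ≤ k → DisjointOccurrences.C k 2 = k ^ 2 + k + 1) ∧
    (∀ k : ℕ, 1 ≤ k → DisjointOccurrences.C k 3 = k ^ 3 + k ^ 2 + k + 2) :=
  ⟨fun _ => DisjointOccurrences.C_one_left, fun k _ => DisjointOccurrences.C_one_right k,
    fun _ => DisjointOccurrences.C_two_right, fun _ => DisjointOccurrences.C_three_right⟩
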